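/- Let $K=[0,1]^N$ and let $F:\mathbb R^N\to\mathbb R$ be measurable with $|F|\le B_F$ on $K$, $B_F>0$, and with a minimizer $\rho^*$ over $K$. Fix $D\ge 1$, widths $d_0=N,d_1,\dots,d_D=1$ (all $\ge 1$), $d=\max_{0\le i\le D}d_i$ and $B_W>0$. Let $\mathcal H$ be the class of $D$-layer ReLU networks without biases $f(\rho)=W_D\,\sigma(W_{D-1}\sigma(\cdots\sigma(W_1\rho)))$, where $W_k$ is a real $d_k\times d_{k-1}$ matrix with spectral norm at most $B_W$. Put $B=\max\{B_F,B_W^D\}$ and choose the upper bound $B_F$ so that $B\ge 1/100$. Fix $T,m\ge1$. Starting from a point $\hat\rho^{(0)}$, iteration $t=1,\dots,T$ draws a batch of $m$ points $\rho^{(j)}=\hat\rho^{(t-1)}+\xi^{(j)}$, $mt-m<j\le mt$, where for $1\le t<T$ the point $\hat\rho^{(t)}$ is a minimizer over $K$ of a network $f_t\in\mathcal H$ trained in iteration $t$. Assume that $\rho^{(j)}\in K$ almost surely; that for each $t$ the noise vectors $\xi^{(j)}$, $mt-m<j\le mt$, are i.i.d. given $\hat\rho^{(t-1)}$; and that the batch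 of iteration $t$ is independent of the history before it, i.e. of the earlier batches and of $\hat\rho^{(0)},\dots,\hat\rho^{(t-1)}$ together with any other randomness used so far (in particular, different batches are independent). Let $D_t$ be the law of the points of batch $t$. Assume finally that there is a decreasing (not necessarily strictly) function $C$ with $$\sup_{K}|F-f|^2\le C(t)\cdot\frac1t\sum_{s=1}^t\mathbb E_{\rho\sim D_s}\big(F(\rho)-f(\rho)\big)^2\qquad\text{for all } 1\le t\le T,\ f\in\mathcal H .$$ Then for every $\delta>0$, with probability at least $1-\delta$ over the joint law of $\rho^{(1)},\dots,\rho^{(mT)}$, the following holds simultaneously for every $f_T\in\mathcal H$ (so for any network trained on these data), every $\epsilon\ge\frac1{mT}\sum_{i=1}^{mT}(F(\rho^{(i)})-f_T(\rho^{(i)}))^2$ and every minimizer $\hat\rho^{(T)}$ of $f_T$ over $K$: $$\big(F(\hat\rho^{(T)})-F(\rho^*)\big)^2\le 4C(T)\Big(\frac{96B^2}{\sqrt{mT}}\sqrt{d^2D\log\big(1+8BB_W^DD\sqrt{mTd}\big)}+12B^2\sqrt{\frac{2\log(2/\delta)}{mT}}+\frac{8}{mT}+\epsilon\Big).$$ Moreover,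 with $B,B_W,D,d,\delta$ fixed, the sum of the first three terms in the bracket, with $mT$ replaced by $n$, is $O(\sqrt{\log n/n})$ as $n\to\infty$, i.e. $\tilde O(1/\sqrt n)$. -/

import Mathlib

open MeasureTheory ProbabilityTheory Filter Asymptotics

noncomputable section

namespace Solo

/-- The design space `ℝ^N` with its Euclidean structure. -/
abbrev Design (N : ℕ) : Type := EuclideanSpace ℝ (Fin N)

/-- The feasible box `K = {ρ | 0 ≤ ρ_i ≤ 1}`. -/
def box (N : ℕ) : Set (Design N) := {x | ∀ i, 0 ≤ x i ∧ x i ≤ 1}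

/-- `ρ` is a minimizer of `f` over the box. -/
def IsBoxMin {N : ℕ} (f : Design N → ℝ) (ρ : Design N) : Prop :=
  ρ ∈ box N ∧ ∀ x ∈ box N, f ρ ≤ f x

/-! ### ReLU networks -/

/-- Coordinatewise ReLU. -/
def relu {n : ℕ} (v : Fin n → ℝ) : Fin n → ℝ := fun i => max (v i) 0

open scoped Matrix.Norms.L2Operator in
/-- The spectral norm of a matrix. -/
def specNorm {a b : ℕ} (A : Matrix (Fin a) (Fin b) ℝ) : ℝ := ‖A‖

/-- Weights for layers of widths `w 0, w 1, w 2, …`; `W k` maps layer `k` to layer `k + 1`. -/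
abbrev Weights (w : ℕ → ℕ) : Type := (k : ℕ) → Matrix (Fin (w (k + 1))) (Fin (w k)) ℝ

/-- The output of the first `k` linear layers, with a ReLU between two consecutive ones
and none after the last one: `x`, `W₁ x`, `W₂ σ(W₁ x)`, … -/
def preact {w : ℕ → ℕ} (W : Weights w) : (k : ℕ) → Design (w 0) → (Fin (w k) → ℝ)
  | 0, x => fun i => x i
  | 1, x => Matrix.mulVec (W 0) (fun i => x i)
  | k + 2, x => Matrix.mulVec (W (k + 1)) (relu (preact W (k + 1) x))

/-- The scalar function of a `D`-layer network with output width `w D = 1`. -/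
def network {w : ℕ → ℕ} {D : ℕ} (hout : w D = 1) (W : Weights w) (x : Design (w 0)) : ℝ :=
  preact W D x (Fin.cast hout.symm 0)

/-- All `D`-layer ReLU networks of the given widths whose `D` weight matrices have spectral norm
at most `BW`. -/
def netClass {w : ℕ → ℕ} {D : ℕ} (hout : w D = 1) (BW : ℝ) : Set (Design (w 0) → ℝ) :=
  {f | ∃ W : Weights w, (∀ k < D, specNorm (W k) ≤ BW) ∧ f = network hout W}

/-- The largest of the widths `w 0, …, w D`, input and output included. -/
def maxWidth (w : ℕ → ℕ) (D : ℕ) : ℕ := (Finset.range (D + 1)).sup w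

/-! ### The sampling process -/

/-- The `j`-th point of batch `s` (the one drawn in iteration `s + 1`): the current empirical
minimizer plus noise. -/
def sample {Ω : Type*} {N m : ℕ} (rhat : ℕ → Ω → Design N) (xi : ℕ → Fin m → Ω → Design N)
    (s : ℕ) (j : Fin m) (ω : Ω) : Design N := rhat s ω + xi s j ω

/-- Batch `s` as one random vector. -/
def batch {Ω : Type*} {N m : ℕ} (rhat : ℕ → Ω → Design N) (xi : ℕ → Fin m → Ω → Design N)
    (s : ℕ) (ω : Ω) : Fin m → Design N := fun j => sample rhat xi s j ω

/-- The whole training set after `T` iterations. -/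
def dataset {Ω : Type*} {N m : ℕ} (rhat : ℕ → Ω → Design N) (xi : ℕ → Fin m → Ω → Design N)
    (T : ℕ) (ω : Ω) : Fin T → Fin m → Design N := fun s j => sample rhat xi s j ω

/-- Given the random point `c`, the random vectors `ξ j` are independent with one common law
`κ (c, ·)`. -/
def IIDGiven {Ω : Type*} [MeasurableSpace Ω] (μ : Measure Ω) {N m : ℕ}
    (c : Ω → Design N) (ξ : Fin m → Ω → Design N) : Prop :=
  ∃ κ : Kernel (Design N) (Design N), IsMarkovKernel κ ∧
    ∀ (S : Set (Design N)) (A : Fin m → Set (Design N)),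
      MeasurableSet S → (∀ j, MeasurableSet (A j)) →
        μ (c ⁻¹' S ∩ ⋂ j, ξ j ⁻¹' A j) = ∫⁻ ω in c ⁻¹' S, ∏ j, κ (c ω) (A j) ∂μ

/-- A run of `T` iterations with batches of `m` points. `ℱ s` is the history before batch `s` is
drawn (earlier batches and any randomness used in earlier training); `net s` is the network trained
in iteration `s` and `rhat s` its minimizer, `rhat 0` being the initial point. -/
structure IsRun {Ω : Type*} [mΩ : MeasurableSpace Ω] (μ : Measure Ω) {N m : ℕ}
    (H : Set (Design N → ℝ)) (T : ℕ) (ℱ : Filtration ℕ mΩ) (net : ℕ → Ω → Design N → ℝ)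
    (rhat : ℕ → Ω → Design N) (xi : ℕ → Fin m → Ω → Design N) : Prop where
  /-- The trained networks belong to the class, and the next centre minimizes the network. -/
  net_mem : ∀ s, 1 ≤ s → s < T → ∀ ω, net s ω ∈ H
  rhat_min : ∀ s, 1 ≤ s → s < T → ∀ ω, IsBoxMin (net s ω) (rhat s ω)
  /-- The centre of batch `s` is known before the batch is drawn, the batch afterwards. -/
  rhat_adapted : ∀ s < T, Measurable[ℱ s] (rhat s)
  xi_adapted : ∀ s < T, ∀ j, Measurable[ℱ (s + 1)] (xi s j)
  /-- The sampled points are feasible. -/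
  sample_mem : ∀ s < T, ∀ j, ∀ᵐ ω ∂μ, sample rhat xi s j ω ∈ box N
  /-- In each iteration, given its centre, the noise is i.i.d. -/
  noise_iid : ∀ s < T, IIDGiven μ (rhat s) (xi s)
  /-- Each batch is independent of the history before it, in particular of the other batches. -/
  batch_indep : ∀ s < T,
    Indep (ℱ s) (MeasurableSpace.comap (batch rhat xi s) inferInstance) μ

/-- The law of the sampled points of batch `s` (they all have the same law). -/
def batchLaw {Ω : Type*} [MeasurableSpace Ω] (μ : Measure Ω) {N m : ℕ} [NeZero m]
    (rhat : ℕ → Ω → Design N) (xi : ℕ → Fin m → Ω → Design N) (s : ℕ) : Measure (Design N) :=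
  μ.map (sample rhat xi s 0)

/-- The average over the first `t` batches of the expected squared error `(F - f)²`. -/
def avgLoss {Ω : Type*} [MeasurableSpace Ω] (μ : Measure Ω) {N m : ℕ} [NeZero m]
    (rhat : ℕ → Ω → Design N) (xi : ℕ → Fin m → Ω → Design N)
    (F f : Design N → ℝ) (t : ℕ) : ℝ :=
  (∑ s ∈ Finset.range t, ∫ x, (F x - f x) ^ 2 ∂(batchLaw μ rhat xi s)) / t

/-- The sup-distance of two functions over the box. -/
def boxDist {N : ℕ} (F f : Design N → ℝ) : ℝ := ⨆ x : box N, |F x - f x|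

/-- The empirical mean squared error of `f` on a data set of `T` batches of `m` points. -/
def empMSE {N m T : ℕ} (F f : Design N → ℝ) (x : Fin T → Fin m → Design N) : ℝ :=
  (∑ s, ∑ j, (F (x s j) - f (x s j)) ^ 2) / ((m : ℝ) * T)

/-- The statistical part of the error bound for `n` training points. -/
def statError (B BW : ℝ) (D d : ℕ) (δ n : ℝ) : ℝ :=
  96 * B ^ 2 / √n *
      √((d : ℝ) ^ 2 * D * Real.log (1 + 8 * B * BW ^ D * D * √(n * d)))
    + 12 * B ^ 2 * √(2 * Real.log (2 / δ) / n) + 8 / n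

end Solo

end

/-! The result is a uniform deviation bound for the squared loss truncated at `B²`. A network is
bounded on the box only by `BW ^ D * √N`, so the plain loss would bring powers of `N` into
Hoeffding's inequality. The truncated loss lies in `[0, B²]` and is `2B`-Lipschitz in the network's
value.

Truncation costs nothing. With `S` the sup-distance and `0 ≤ u ≤ S²`, one has `min (S², B²) * u ≤ S²
* min (u, B²)`. Hence the hypothesis comparing `S²` with the mean loss also compares `min (S², B²)`
with the mean truncated loss (`IsRun.min_sq_boxDist_le`). Since `|F| ≤ B`, the suboptimality is at
most `2S` and at most `2B`, so `min (S², B²)` is all that is needed (`sq_sub_le_min`).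

Uniformity over the class comes from a finite net (`exists_net_netClass`): the weights fill a ball
in a space of dimension at most `d²D`, a volume argument covers it, and the network depends on its
weights in a Lipschitz way. A union bound over the net gives a good event that does not depend on
the trained network (`IsRun.exists_good_set`).

Hoeffding needs independent samples, although each centre depends on earlier data. Given the centre,
the batch is i.i.d.; being also independent of the centre, it has a constant conditional law, so its
points are unconditionally i.i.d. (`measure_inter_sample_eq_prod`). The filtration then gives
independence across batches. -/

noncomputable section

namespace Solo

/-! ### Covering a ball in a finite-dimensional normed space -/

section Covering

variable {E : Type*} [NormedAddCommGroup E] [NormedSpace ℝ E] [FiniteDimensional ℝ E]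

open Metric Module in
open scoped Function in
/-- Volume bound for an `η`-separated subset of a ball of radius `R`. -/
theorem card_le_of_separated_of_norm_le {R η : ℝ} (hR : 0 ≤ R) (hη : 0 < η) (s : Finset E)
    (hs : ∀ c ∈ s, ‖c‖ ≤ R) (h : ∀ c ∈ s, ∀ d ∈ s, c ≠ d → η ≤ ‖c - d‖) :
    (s.card : ℝ) ≤ (1 + 2 * R / η) ^ finrank ℝ E := by
  borelize E
  let μ : Measure E := Measure.addHaar
  have hδ : 0 < η / 2 := by positivity
  have hρ : 0 < R + η / 2 := by positivity
  -- Balls of half the separation are disjoint and stay within radius `R + η / 2`; comparing volumes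
  -- bounds their number.
  set A := ⋃ c ∈ s, ball (c : E) (η / 2) with hA
  have hD : Set.Pairwise (s : Set E) (Disjoint on fun c => ball (c : E) (η / 2)) := by
    rintro c hc d hd hcd
    apply ball_disjoint_ball
    rw [dist_eq_norm]
    linarith [h c hc d hd hcd]
  have hsub : A ⊆ ball (0 : E) (R + η / 2) := by
    refine Set.iUnion₂_subset fun x hx => ball_subset_ball' ?_
    rw [dist_zero_right]
    linarith [hs x hx]
  have h1 : (s.card : ENNReal) * ENNReal.ofReal ((η / 2) ^ finrank ℝ E) * μ (ball 0 1) ≤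
      ENNReal.ofReal ((R + η / 2) ^ finrank ℝ E) * μ (ball 0 1) :=
    calc
      _ = μ A := by
        rw [hA, measure_biUnion_finset hD fun c _ => measurableSet_ball]
        simp only [μ.addHaar_ball_of_pos _ hδ, Finset.sum_const, nsmul_eq_mul, mul_assoc]
      _ ≤ μ (ball (0 : E) (R + η / 2)) := measure_mono hsub
      _ = _ := by simp only [μ.addHaar_ball_of_pos _ hρ]
  have h2 : (s.card : ENNReal) * ENNReal.ofReal ((η / 2) ^ finrank ℝ E) ≤
      ENNReal.ofReal ((R + η / 2) ^ finrank ℝ E) :=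
    (ENNReal.mul_le_mul_iff_left (measure_ball_pos _ _ zero_lt_one).ne' measure_ball_lt_top.ne).1 h1
  have h3 : (s.card : ℝ) * (η / 2) ^ finrank ℝ E ≤ (R + η / 2) ^ finrank ℝ E := by
    have := ENNReal.toReal_le_of_le_ofReal (pow_nonneg hρ.le _) h2
    rwa [ENNReal.toReal_mul, ENNReal.toReal_natCast, ENNReal.toReal_ofReal (by positivity)] at this
  have h4 : 1 + 2 * R / η = (R + η / 2) / (η / 2) := by field_simp; ring
  rw [h4, div_pow, le_div_iff₀ (by positivity)]
  exact h3

/-- A ball of radius `R` has an `η`-net of at most `(1 + 2R/η) ^ dim` points. -/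
theorem exists_net_closedBall {R η : ℝ} (hR : 0 ≤ R) (hη : 0 < η) :
    ∃ s : Finset E, (∀ c ∈ s, ‖c‖ ≤ R) ∧ (∀ x : E, ‖x‖ ≤ R → ∃ c ∈ s, ‖x - c‖ ≤ η) ∧
      (s.card : ℝ) ≤ (1 + 2 * R / η) ^ Module.finrank ℝ E := by
  classical
  -- If no net were this small, a separated set, being small by volume, would never cover the ball
  -- and could always be enlarged, against the same volume bound.
  by_contra! hno
  have key : ∀ k : ℕ, ∃ s : Finset E, s.card = k ∧ (∀ c ∈ s, ‖c‖ ≤ R) ∧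
      ∀ c ∈ s, ∀ d ∈ s, c ≠ d → η ≤ ‖c - d‖ := by
    intro k
    induction k with
    | zero => exact ⟨∅, by simp⟩
    | succ k ih =>
      obtain ⟨s, hk, hs, hsep⟩ := ih
      have hex : ∃ x : E, ‖x‖ ≤ R ∧ ∀ c ∈ s, η < ‖x - c‖ := by
        by_contra! hcov
        exact absurd (card_le_of_separated_of_norm_le hR hη s hs hsep) (not_le.2 (hno s hs hcov))
      obtain ⟨x, hxR, hx⟩ := hex
      have hxs : x ∉ s := fun hxs => by
        have := hx x hxs
        rw [sub_self, norm_zero] at this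
        exact absurd this hη.not_gt
      refine ⟨insert x s, by rw [Finset.card_insert_of_notMem hxs, hk], ?_, ?_⟩
      · intro c hc
        rcases Finset.mem_insert.1 hc with rfl | hc
        exacts [hxR, hs c hc]
      · intro c hc d hd hcd
        rcases Finset.mem_insert.1 hc with hc' | hc' <;> rcases Finset.mem_insert.1 hd with hd' | hd'
        · exact absurd (hc'.trans hd'.symm) hcd
        · rw [hc']; exact (hx d hd').le
        · rw [hd', norm_sub_rev]; exact (hx c hc').le
        · exact hsep c hc' d hd' hcd
  obtain ⟨k, hk⟩ := exists_nat_gt ((1 + 2 * R / η) ^ Module.finrank ℝ E)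
  obtain ⟨s, rfl, hs, hsep⟩ := key k
  exact absurd (card_le_of_separated_of_norm_le hR hη s hs hsep) (not_le.2 hk)

end Covering

/-! ### Lipschitz dependence on the weights and a net for the network class -/

section Networks

theorem norm_mulVec_le {a b : ℕ} (A : Matrix (Fin a) (Fin b) ℝ) (v : Fin b → ℝ) :
    ‖WithLp.toLp 2 (A.mulVec v)‖ ≤ specNorm A * ‖WithLp.toLp 2 v‖ :=
  A.l2_opNorm_mulVec (WithLp.toLp 2 v)

theorem specNorm_nonneg {a b : ℕ} (A : Matrix (Fin a) (Fin b) ℝ) : 0 ≤ specNorm A := by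
  open scoped Matrix.Norms.L2Operator in exact norm_nonneg A

theorem norm_relu_sub_le {n : ℕ} (u v : Fin n → ℝ) :
    ‖WithLp.toLp 2 (relu u - relu v)‖ ≤ ‖WithLp.toLp 2 (u - v)‖ := by
  rw [EuclideanSpace.norm_eq, EuclideanSpace.norm_eq]
  refine Real.sqrt_le_sqrt (Finset.sum_le_sum fun i _ => ?_)
  have h : |max (u i) 0 - max (v i) 0| ≤ |u i - v i| := abs_max_sub_max_le_abs _ _ _
  simpa [relu] using pow_le_pow_left₀ (abs_nonneg _) h 2

theorem norm_relu_le {n : ℕ} (u : Fin n → ℝ) :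
    ‖WithLp.toLp 2 (relu u)‖ ≤ ‖WithLp.toLp 2 u‖ := by
  have h := norm_relu_sub_le u 0
  have h0 : relu (0 : Fin n → ℝ) = 0 := by ext i; simp [relu]
  rwa [h0, sub_zero, sub_zero] at h

variable {w : ℕ → ℕ} {D : ℕ}

theorem norm_preact_le {W : Weights w} {M : ℝ} (x : Design (w 0)) :
    ∀ k, (∀ i < k, specNorm (W i) ≤ M) → ‖WithLp.toLp 2 (preact W k x)‖ ≤ M ^ k * ‖x‖
  | 0, _ => by simp [preact]
  | 1, h => by
    refine (norm_mulVec_le _ _).trans ?_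
    rw [pow_one]
    exact mul_le_mul_of_nonneg_right (h 0 one_pos) (norm_nonneg _)
  | k + 2, h => by
    have ih := norm_preact_le x (k + 1) fun i hi => h i (by omega)
    have hk := h (k + 1) (by omega)
    have hM := (specNorm_nonneg _).trans hk
    refine (norm_mulVec_le _ _).trans ?_
    calc _ ≤ M * (M ^ (k + 1) * ‖x‖) :=
          mul_le_mul hk ((norm_relu_le _).trans ih) (norm_nonneg _) hM
      _ = M ^ (k + 2) * ‖x‖ := by ring

theorem norm_mulVec_sub_mulVec_le {a b : ℕ} (A A' : Matrix (Fin a) (Fin b) ℝ) (u v : Fin b → ℝ) :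
    ‖WithLp.toLp 2 (A.mulVec u - A'.mulVec v)‖ ≤
      specNorm (A - A') * ‖WithLp.toLp 2 u‖ + specNorm A' * ‖WithLp.toLp 2 (u - v)‖ := by
  have h : A.mulVec u - A'.mulVec v = (A - A').mulVec u + A'.mulVec (u - v) := by
    rw [Matrix.sub_mulVec, Matrix.mulVec_sub]; abel
  rw [h, WithLp.toLp_add]
  exact (norm_add_le _ _).trans (add_le_add (norm_mulVec_le _ _) (norm_mulVec_le _ _))

/-- Perturbing each of the first `k` weight matrices by at most `θ`. -/
theorem norm_preact_sub_preact_le {W W' : Weights w} {M θ : ℝ} (x : Design (w 0)) :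
    ∀ k, (∀ i < k, specNorm (W i) ≤ M) → (∀ i < k, specNorm (W' i) ≤ M) →
      (∀ i < k, specNorm (W i - W' i) ≤ θ) →
      M * ‖WithLp.toLp 2 (preact W k x - preact W' k x)‖ ≤ k * M ^ k * θ * ‖x‖
  | 0, _, _, _ => by simp [preact]
  | 1, h, h', hd => by
    have hM : 0 ≤ M := (specNorm_nonneg _).trans (h 0 one_pos)
    have h1 := norm_mulVec_sub_mulVec_le (W 0) (W' 0) (fun i => x i) (fun i => x i)
    rw [sub_self, WithLp.toLp_zero, norm_zero, mul_zero, add_zero] at h1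
    have h2 : specNorm (W 0 - W' 0) * ‖x‖ ≤ θ * ‖x‖ :=
      mul_le_mul_of_nonneg_right (hd 0 one_pos) (norm_nonneg _)
    calc _ ≤ M * (θ * ‖x‖) := mul_le_mul_of_nonneg_left (h1.trans h2) hM
      _ = _ := by push_cast; ring
  | k + 2, h, h', hd => by
    have ih := norm_preact_sub_preact_le x (k + 1) (fun i hi => h i (by omega))
      (fun i hi => h' i (by omega)) fun i hi => hd i (by omega)
    have hM : 0 ≤ M := (specNorm_nonneg _).trans (h 0 (by omega))
    have hθ : 0 ≤ θ := (specNorm_nonneg _).trans (hd 0 (by omega))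
    -- The new error is that of the last matrix on the old signal, plus the old error amplified by
    -- at most `M`, ReLU being 1-Lipschitz.
    have h1 := norm_mulVec_sub_mulVec_le (W (k + 1)) (W' (k + 1)) (relu (preact W (k + 1) x))
      (relu (preact W' (k + 1) x))
    have h2 : specNorm (W (k + 1) - W' (k + 1)) * ‖WithLp.toLp 2 (relu (preact W (k + 1) x))‖ ≤
        θ * (M ^ (k + 1) * ‖x‖) :=
      mul_le_mul (hd _ (by omega))
        ((norm_relu_le _).trans (norm_preact_le x (k + 1) fun i hi => h i (by omega)))
        (norm_nonneg _) hθ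
    have h3 : specNorm (W' (k + 1)) * ‖WithLp.toLp 2
        (relu (preact W (k + 1) x) - relu (preact W' (k + 1) x))‖ ≤
        M * ‖WithLp.toLp 2 (preact W (k + 1) x - preact W' (k + 1) x)‖ :=
      mul_le_mul (h' _ (by omega)) (norm_relu_sub_le _ _) (norm_nonneg _) hM
    calc _ ≤ M * (θ * (M ^ (k + 1) * ‖x‖) + ((k + 1 : ℕ) : ℝ) * M ^ (k + 1) * θ * ‖x‖) :=
          mul_le_mul_of_nonneg_left (h1.trans (add_le_add h2 (h3.trans ih))) hM
      _ = _ := by push_cast; ring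

theorem norm_le_of_mem_box {N : ℕ} {x : Design N} (hx : x ∈ box N) : ‖x‖ ≤ √N := by
  rw [EuclideanSpace.norm_eq]
  refine Real.sqrt_le_sqrt ?_
  calc ∑ i, ‖x i‖ ^ 2 ≤ ∑ _i : Fin N, (1 : ℝ) := by
        refine Finset.sum_le_sum fun i _ => ?_
        rw [Real.norm_eq_abs, sq_abs]
        exact pow_le_one₀ (hx i).1 (hx i).2
    _ = N := by simp

/-- The layerwise estimate carries a factor `M` on its left to avoid the exponent `D - 1`; it is
divided out here. -/
theorem abs_network_sub_le (hD : 1 ≤ D) (hout : w D = 1) {W W' : Weights w} {M θ : ℝ} (hM : 0 < M)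
    (h : ∀ i < D, specNorm (W i) ≤ M) (h' : ∀ i < D, specNorm (W' i) ≤ M)
    (hd : ∀ i < D, specNorm (W i - W' i) ≤ θ) {x : Design (w 0)} (hx : x ∈ box (w 0)) :
    |network hout W x - network hout W' x| ≤ D * M ^ D * θ * √(w 0) / M := by
  have hθ : 0 ≤ θ := (specNorm_nonneg _).trans (hd 0 (by omega))
  rw [le_div_iff₀ hM, mul_comm]
  have h1 := norm_preact_sub_preact_le x D h h' hd
  have h2 := PiLp.norm_apply_le (p := 2) (WithLp.toLp 2 (preact W D x - preact W' D x))
    (Fin.cast hout.symm 0)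
  calc _ ≤ M * ‖WithLp.toLp 2 (preact W D x - preact W' D x)‖ :=
        mul_le_mul_of_nonneg_left h2 hM.le
    _ ≤ _ := h1
    _ ≤ _ := mul_le_mul_of_nonneg_left (norm_le_of_mem_box hx) (by positivity)

theorem abs_network_le (hout : w D = 1) {W : Weights w} {M : ℝ} (hM : 0 ≤ M)
    (h : ∀ i < D, specNorm (W i) ≤ M) {x : Design (w 0)} (hx : x ∈ box (w 0)) :
    |network hout W x| ≤ M ^ D * √(w 0) := by
  have h2 := PiLp.norm_apply_le (p := 2) (WithLp.toLp 2 (preact W D x)) (Fin.cast hout.symm 0)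
  exact (h2.trans (norm_preact_le x D h)).trans
    (mul_le_mul_of_nonneg_left (norm_le_of_mem_box hx) (by positivity))

theorem continuous_relu {n : ℕ} : Continuous (relu (n := n)) := by
  unfold relu; fun_prop

theorem continuous_preact (W : Weights w) : ∀ k, Continuous (preact W k)
  | 0 => by
    change Continuous fun (x : Design (w 0)) i => x i
    fun_prop
  | 1 => by
    change Continuous fun x : Design (w 0) => (W 0).mulVec fun i => x i
    exact Continuous.matrix_mulVec continuous_const (by fun_prop)
  | k + 2 => by
    change Continuous fun x => (W (k + 1)).mulVec (relu (preact W (k + 1) x))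
    exact Continuous.matrix_mulVec continuous_const (continuous_relu.comp (continuous_preact W _))

theorem continuous_network (hout : w D = 1) (W : Weights w) : Continuous (network hout W) :=
  (continuous_apply _).comp (continuous_preact W D)

theorem preact_congr {W W' : Weights w} (x : Design (w 0)) :
    ∀ k, (∀ i < k, W i = W' i) → preact W k x = preact W' k x
  | 0, _ => rfl
  | 1, h => by simp only [preact, h 0 one_pos]
  | k + 2, h => by
    simp only [preact, h (k + 1) (by omega), preact_congr x (k + 1) fun i hi => h i (by omega)]

/-- The first `D` weight matrices. -/
abbrev Layers (w : ℕ → ℕ) (D : ℕ) : Type :=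
  (k : Fin D) → Matrix (Fin (w (k + 1))) (Fin (w k)) ℝ

/-- Extend the first `D` weight matrices by zero. -/
def Layers.extend (V : Layers w D) : Weights w := fun k => if h : k < D then V ⟨k, h⟩ else 0

theorem Layers.extend_of_lt (V : Layers w D) {k : ℕ} (h : k < D) : V.extend k = V ⟨k, h⟩ :=
  dif_pos h

theorem finrank_layers_le {d : ℕ} (hd : ∀ k ≤ D, w k ≤ d) :
    Module.finrank ℝ (Layers w D) ≤ d ^ 2 * D := by
  rw [Module.finrank_pi_fintype]
  calc _ ≤ ∑ _k : Fin D, d ^ 2 := by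
        refine Finset.sum_le_sum fun k _ => ?_
        rw [Module.finrank_matrix, Fintype.card_fin, Fintype.card_fin, Module.finrank_self, mul_one,
          sq]
        exact Nat.mul_le_mul (hd _ (by omega)) (hd _ (by omega))
    _ = d ^ 2 * D := by simp [mul_comm]

open scoped Matrix.Norms.L2Operator Classical in
/-- The network class has an `η`-net in sup-distance on the box, of size given by the number of
parameters. -/
theorem exists_net_netClass (hD : 1 ≤ D) (hw : ∀ k ≤ D, 1 ≤ w k) (hout : w D = 1) {M η : ℝ}
    (hM : 0 < M) (hη : 0 < η) {d : ℕ} (hd : ∀ k ≤ D, w k ≤ d) :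
    ∃ s : Finset (Design (w 0) → ℝ), (∀ g ∈ s, g ∈ netClass hout M) ∧
      (∀ f ∈ netClass hout M, ∃ g ∈ s, ∀ x ∈ box (w 0), |f x - g x| ≤ η) ∧
      (s.card : ℝ) ≤ (1 + 2 * M ^ D * D * √d / η) ^ (d ^ 2 * D) := by
  have hd0 : 0 < d := (hw 0 (Nat.zero_le _)).trans (hd 0 (Nat.zero_le _))
  have hsd : 0 < √(d : ℝ) := Real.sqrt_pos.2 (by exact_mod_cast hd0)
  have hD0 : (0 : ℝ) < D := by exact_mod_cast hD
  -- Chosen so that weight error `θ` per layer becomes exactly output error `η`.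
  set θ : ℝ := η * M / (M ^ D * D * √d) with hθ
  have hθ0 : 0 < θ := by positivity
  -- The norm on `Layers w D` is the maximum of the spectral norms, so the admissible weights are
  -- exactly its ball of radius `M`.
  obtain ⟨s, hsM, hsnet, hcard⟩ := exists_net_closedBall (E := Layers w D) hM.le hθ0
  have hlay : ∀ V : Layers w D, ‖V‖ ≤ M → ∀ k < D, specNorm (V.extend k) ≤ M := by
    intro V hV k hk
    rw [V.extend_of_lt hk]
    exact (norm_le_pi_norm V ⟨k, hk⟩).trans hV
  refine ⟨s.image fun V => network hout V.extend, ?_, ?_, ?_⟩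
  · intro g hg
    obtain ⟨V, hV, rfl⟩ := Finset.mem_image.1 hg
    exact ⟨V.extend, hlay V (hsM V hV), rfl⟩
  · rintro f ⟨W, hW, rfl⟩
    obtain ⟨V, hV, hWV⟩ := hsnet (fun k => W k) ((pi_norm_le_iff_of_nonneg hM.le).2
      fun k => hW k k.2)
    refine ⟨_, Finset.mem_image_of_mem _ hV, fun x hx => ?_⟩
    refine (abs_network_sub_le hD hout hM hW (hlay V (hsM V hV)) (θ := θ) (fun i hi => ?_) hx).trans
      ?_
    · rw [V.extend_of_lt hi]
      exact (norm_le_pi_norm ((fun k : Fin D => W k) - V) ⟨i, hi⟩).trans hWV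
    · have h0 : √(w 0 : ℝ) ≤ √d := Real.sqrt_le_sqrt (by exact_mod_cast hd 0 (Nat.zero_le _))
      calc _ ≤ D * M ^ D * θ * √d / M := by gcongr
        _ = η := by rw [hθ]; field_simp
  · calc ((s.image fun V => network hout V.extend).card : ℝ) ≤ s.card := by
          exact_mod_cast Finset.card_image_le
      _ ≤ _ := hcard
      _ = (1 + 2 * M ^ D * D * √d / η) ^ Module.finrank ℝ (Layers w D) := by
          congr 2; rw [hθ]; field_simp
      _ ≤ _ := pow_le_pow_right₀ (le_add_of_nonneg_right (by positivity)) (finrank_layers_le hd)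

end Networks

/-! ### From conditionally i.i.d. noise to independent samples -/

section Independence

variable {α β ι : Type*} [MeasurableSpace α] [MeasurableSpace β] [Fintype ι]

/-- The kernel of `ι` independent draws from `κ`. -/
def iidKernel (ι : Type*) [Fintype ι] (κ : Kernel α β) [IsMarkovKernel κ] :
    Kernel α (ι → β) where
  toFun a := Measure.pi fun _ => κ a
  measurable' := by
    refine Measurable.measure_of_isPiSystem_of_isProbabilityMeasure generateFrom_pi.symm
      isPiSystem_pi ?_
    rintro _ ⟨A, hA, rfl⟩
    simp only [Measure.pi_pi]
    exact Finset.measurable_prod _ fun i _ => κ.measurable_coe (hA i (Set.mem_univ i))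

instance (κ : Kernel α β) [IsMarkovKernel κ] : IsMarkovKernel (iidKernel ι κ) :=
  ⟨fun a => by change IsProbabilityMeasure (Measure.pi fun _ : ι => κ a); infer_instance⟩

theorem iidKernel_pi (κ : Kernel α β) [IsMarkovKernel κ] (a : α) (A : ι → Set β) :
    iidKernel ι κ a (Set.univ.pi A) = ∏ i, κ a (A i) :=
  Measure.pi_pi _ _

/-- The event that one point of the batch lies in `E`. -/
theorem batch_preimage_pi_update {Ω : Type*} {N m : ℕ} (rhat : ℕ → Ω → Design N) (xi : ℕ → Fin m → Ω → Design N) (s : ℕ)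
    (j : Fin m) (E : Set (Design N)) :
    batch rhat xi s ⁻¹' Set.univ.pi (Function.update (fun _ => Set.univ) j E) =
      sample rhat xi s j ⁻¹' E := by
  ext ω
  simp only [Set.mem_preimage, Set.mem_univ_pi]
  refine ⟨fun h => by have := h j; rwa [Function.update_self] at this, fun h i => ?_⟩
  by_cases hi : i = j
  · subst hi; rwa [Function.update_self]
  · simp [Function.update_of_ne hi]

theorem measurableSet_update_univ {N m : ℕ} {E : Set (Design N)} (hE : MeasurableSet E) (j i : Fin m) :
    MeasurableSet (Function.update (fun _ => Set.univ) j E i) := by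
  by_cases hi : i = j
  · subst hi; simpa using hE
  · simp [Function.update_of_ne hi]

theorem measurable_batch {Ω : Type*} {mΩ : MeasurableSpace Ω} {N m : ℕ} {rhat : ℕ → Ω → Design N}
    {xi : ℕ → Fin m → Ω → Design N} {s : ℕ} (hc : Measurable (rhat s))
    (hξ : ∀ j, Measurable (xi s j)) : Measurable (batch rhat xi s) :=
  measurable_pi_lambda _ fun j => hc.add (hξ j)

variable {Ω : Type*} [MeasurableSpace Ω] {μ : Measure Ω} [IsProbabilityMeasure μ]

/-- The formula defining a conditionally i.i.d. family determines the joint law. -/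
theorem map_prodMk_eq_compProd_iidKernel {c : Ω → α} {ξ : Ω → ι → β} (hc : Measurable c)
    (hξ : Measurable ξ) (κ : Kernel α β) [IsMarkovKernel κ]
    (h : ∀ (S : Set α) (A : ι → Set β), MeasurableSet S → (∀ j, MeasurableSet (A j)) →
      μ (c ⁻¹' S ∩ ξ ⁻¹' Set.univ.pi A) = ∫⁻ ω in c ⁻¹' S, ∏ j, κ (c ω) (A j) ∂μ) :
    μ.map (fun ω => (c ω, ξ ω)) = (μ.map c).compProd (iidKernel ι κ) := by
  have : IsProbabilityMeasure (μ.map c) := Measure.isProbabilityMeasure_map hc.aemeasurable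
  have hL : ∀ {S : Set α} {E : Set (ι → β)}, MeasurableSet S → MeasurableSet E →
      μ.map (fun ω => (c ω, ξ ω)) (S ×ˢ E) = (μ.restrict (c ⁻¹' S)).map ξ E := by
    intro S E hS hE
    rw [Measure.map_apply (hc.prodMk hξ) (hS.prod hE), Measure.map_apply hξ hE,
      Measure.restrict_apply (hξ hE), Set.inter_comm]
    rfl
  have hR : ∀ {S : Set α} {E : Set (ι → β)}, MeasurableSet S → MeasurableSet E →
      (μ.map c).compProd (iidKernel ι κ) (S ×ˢ E) =
        ((μ.map c).restrict S).bind (iidKernel ι κ) E := by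
    intro S E hS hE
    rw [Measure.compProd_apply_prod hS hE, Measure.bind_apply hE (Kernel.aemeasurable _)]
  -- Rectangles suffice. For fixed `S` both sides are finite measures in `E`, hence determined on
  -- the π-system of boxes, where `h` applies.
  refine Measure.ext_prod fun {S E} hS hE => ?_
  rw [hL hS hE, hR hS hE]
  congr 1
  have hpi : ∀ A : ι → Set β, (∀ j, MeasurableSet (A j)) →
      (μ.restrict (c ⁻¹' S)).map ξ (Set.univ.pi A) =
        ((μ.map c).restrict S).bind (iidKernel ι κ) (Set.univ.pi A) := by
    intro A hA
    have hE : MeasurableSet (Set.univ.pi A) := MeasurableSet.univ_pi hA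
    rw [Measure.map_apply hξ hE, Measure.restrict_apply (hξ hE), Set.inter_comm, h S A hS hA,
      Measure.bind_apply hE (Kernel.aemeasurable _), setLIntegral_map hS
        (Kernel.measurable_coe _ hE) hc]
    simp only [iidKernel_pi]
  refine ext_of_generate_finite _ generateFrom_pi.symm isPiSystem_pi ?_ ?_
  · rintro _ ⟨A, hA, rfl⟩
    exact hpi A fun j => hA j (Set.mem_univ j)
  · simpa using hpi (fun _ => Set.univ) fun _ => MeasurableSet.univ

variable {N m : ℕ} {rhat : ℕ → Ω → Design N} {xi : ℕ → Fin m → Ω → Design N}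

/-- If the noise is i.i.d. given the centre and the batch is independent of the centre, then the
points of the batch are independent with one common law. -/
theorem measure_inter_sample_eq_prod [NeZero m] {s : ℕ} (hc : Measurable (rhat s))
    (hξ : ∀ j, Measurable (xi s j)) (hiid : IIDGiven μ (rhat s) (xi s))
    (hind : IndepFun (rhat s) (batch rhat xi s) μ) (A : Fin m → Set (Design N))
    (hA : ∀ j, MeasurableSet (A j)) :
    μ (batch rhat xi s ⁻¹' Set.univ.pi A) = ∏ j, batchLaw μ rhat xi s (A j) := by
  obtain ⟨κ, hκ, hform⟩ := hiid
  have hξ' : Measurable fun ω j => xi s j ω := measurable_pi_lambda _ hξ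
  have hlaw := map_prodMk_eq_compProd_iidKernel (ι := Fin m) hc hξ' κ (μ := μ) (by
    intro S A hS hA
    rw [← hform S A hS hA]
    congr 2
    ext ω
    simp)
  have hcprob : IsProbabilityMeasure (μ.map (rhat s)) :=
    Measure.isProbabilityMeasure_map hc.aemeasurable
  -- the conditional probability that one shifted noise vector falls into `E`
  set q : Set (Design N) → Design N → ENNReal := fun E a => κ a ((fun y => a + y) ⁻¹' E) with hq
  have hqm : ∀ E, MeasurableSet E → Measurable (q E) := fun E hE =>
    Kernel.measurable_kernel_prodMk_left (κ := κ)
      (measurable_fst.add measurable_snd hE : MeasurableSet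
        ((fun p : Design N × Design N => p.1 + p.2) ⁻¹' E))
  -- The product is the conditional probability of the batch event given the centre. By independence
  -- its integral over every `S` is that of a constant, so it is a.e. constant.
  have hae : ∀ A : Fin m → Set (Design N), (∀ j, MeasurableSet (A j)) →
      ∀ᵐ a ∂μ.map (rhat s), ∏ j, q (A j) a = μ (batch rhat xi s ⁻¹' Set.univ.pi A) := by
    intro A hA
    have hAm : MeasurableSet (Set.univ.pi A) := MeasurableSet.univ_pi hA
    refine ae_eq_of_forall_setLIntegral_eq_of_sigmaFinite
      (Finset.measurable_prod _ fun j _ => hqm _ (hA j)) measurable_const fun S hS _ => ?_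
    rw [setLIntegral_const, mul_comm, Measure.map_apply hc hS,
      ← hind.measure_inter_preimage_eq_mul _ _ hS hAm]
    have hP : MeasurableSet {p : Design N × (Fin m → Design N) |
        p.1 ∈ S ∧ (fun j => p.1 + p.2 j) ∈ Set.univ.pi A} :=
      (measurable_fst hS).inter
        ((measurable_pi_lambda _ fun j => measurable_fst.add
          ((measurable_pi_apply j).comp measurable_snd) :
          Measurable fun p : Design N × (Fin m → Design N) => fun j => p.1 + p.2 j) hAm)
    have h1 := congrArg (fun ν => ν {p : Design N × (Fin m → Design N) |
        p.1 ∈ S ∧ (fun j => p.1 + p.2 j) ∈ Set.univ.pi A}) hlaw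
    simp only [] at h1
    rw [Measure.map_apply (hc.prodMk hξ') hP, Measure.compProd_apply hP] at h1
    have h2 : rhat s ⁻¹' S ∩ batch rhat xi s ⁻¹' Set.univ.pi A =
        (fun ω => (rhat s ω, fun j => xi s j ω)) ⁻¹' {p : Design N × (Fin m → Design N) |
          p.1 ∈ S ∧ (fun j => p.1 + p.2 j) ∈ Set.univ.pi A} := by
      ext ω; simp [batch, sample]
    rw [h2, h1, ← lintegral_indicator hS]
    refine lintegral_congr fun a => ?_
    by_cases ha : a ∈ S
    · rw [Set.indicator_of_mem ha, ← iidKernel_pi]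
      congr 1
      ext y
      simp [ha]
    · simp [ha]
  classical
  have hone : ∀ j, ∀ᵐ a ∂μ.map (rhat s), q (A j) a = batchLaw μ rhat xi s (A j) := by
    intro j
    -- The constraint sits at index `0` whatever `j` is: the conditional law is common to all
    -- coordinates.
    filter_upwards [hae (Function.update (fun _ => Set.univ) 0 (A j)) (measurableSet_update_univ (hA j) 0)] with a ha
    rw [Fintype.prod_eq_single 0 (fun i hi => by simp [hq, Function.update_of_ne hi]),
      Function.update_self] at ha
    rw [ha, batchLaw, Measure.map_apply (f := sample rhat xi s 0) (hc.add (hξ 0)) (hA j),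
      batch_preimage_pi_update]
  -- The identity to prove involves only constants, so a single typical centre suffices.
  obtain ⟨a, ha, ha'⟩ := ((hae A hA).and (ae_all_iff.2 hone)).exists
  rw [← ha]
  exact Finset.prod_congr rfl fun j _ => ha' j

/-! ### Independence of all sampled points of a run -/

section Run

variable {Ω : Type*} [mΩ : MeasurableSpace Ω] {μ : Measure Ω} {N m T : ℕ}
  {H : Set (Design N → ℝ)} {ℱ : Filtration ℕ mΩ} {net : ℕ → Ω → Design N → ℝ}
  {rhat : ℕ → Ω → Design N} {xi : ℕ → Fin m → Ω → Design N}

theorem IsRun.measurable_rhat (h : IsRun μ H T ℱ net rhat xi) {s : ℕ} (hs : s < T) :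
    Measurable (rhat s) := (h.rhat_adapted s hs).mono (ℱ.le _) le_rfl

theorem IsRun.measurable_xi (h : IsRun μ H T ℱ net rhat xi) {s : ℕ} (hs : s < T) (j : Fin m) :
    Measurable (xi s j) := (h.xi_adapted s hs j).mono (ℱ.le _) le_rfl

theorem IsRun.measurable_sample (h : IsRun μ H T ℱ net rhat xi) {s : ℕ} (hs : s < T) (j : Fin m) :
    Measurable (sample rhat xi s j) := (h.measurable_rhat hs).add (h.measurable_xi hs j)

theorem IsRun.measurable_dataset (h : IsRun μ H T ℱ net rhat xi) :
    Measurable (dataset rhat xi T) :=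
  measurable_pi_lambda _ fun s => measurable_pi_lambda _ fun j => h.measurable_sample s.2 j

theorem IsRun.batch_adapted (h : IsRun μ H T ℱ net rhat xi) {s : ℕ} (hs : s < T) :
    Measurable[ℱ (s + 1)] (batch rhat xi s) :=
  measurable_batch (mΩ := ℱ (s + 1)) ((h.rhat_adapted s hs).mono (ℱ.mono (Nat.le_succ s)) le_rfl)
    (h.xi_adapted s hs)

variable [IsProbabilityMeasure μ]

/-- Different batches are independent. -/
theorem IsRun.measure_iInter_batch (h : IsRun μ H T ℱ net rhat xi)
    {E : ℕ → Set (Fin m → Design N)} (hE : ∀ s, MeasurableSet (E s)) :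
    ∀ k ≤ T, MeasurableSet[ℱ k] (⋂ s ∈ Finset.range k, batch rhat xi s ⁻¹' E s) ∧
      μ (⋂ s ∈ Finset.range k, batch rhat xi s ⁻¹' E s) =
        ∏ s ∈ Finset.range k, μ (batch rhat xi s ⁻¹' E s) := by
  intro k
  induction k with
  | zero => simp
  | succ k ih =>
    intro hk
    obtain ⟨hm, hμ⟩ := ih (by omega)
    rw [Finset.range_add_one, Finset.set_biInter_insert, Finset.prod_insert (by simp), ← hμ,
      Set.inter_comm, mul_comm]
    refine ⟨MeasurableSet.inter (ℱ.mono (Nat.le_succ k) _ hm) (h.batch_adapted (by omega) (hE k)),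
      ?_⟩
    -- The earlier batches form an event of `ℱ k`, from which batch `k` is independent.
    exact (Indep_iff _ _ μ).1 (h.batch_indep k (by omega)) _ _ hm ⟨E k, hE k, rfl⟩

theorem IsRun.measure_inter_sample [NeZero m] (h : IsRun μ H T ℱ net rhat xi) {s : ℕ} (hs : s < T)
    {A : Fin m → Set (Design N)} (hA : ∀ j, MeasurableSet (A j)) :
    μ (batch rhat xi s ⁻¹' Set.univ.pi A) = ∏ j, batchLaw μ rhat xi s (A j) := by
  refine measure_inter_sample_eq_prod (h.measurable_rhat hs) (h.measurable_xi hs)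
    (h.noise_iid s hs) ?_ A hA
  exact (IndepFun_iff_Indep _ _ _).2
    (indep_of_indep_of_le_left (h.batch_indep s hs) (h.rhat_adapted s hs).comap_le)

/-- All points of a batch have the same law. -/
theorem IsRun.map_sample [NeZero m] (h : IsRun μ H T ℱ net rhat xi) {s : ℕ} (hs : s < T)
    (j : Fin m) : μ.map (sample rhat xi s j) = batchLaw μ rhat xi s := by
  classical
  have : IsProbabilityMeasure (batchLaw μ rhat xi s) :=
    Measure.isProbabilityMeasure_map (h.measurable_sample hs 0).aemeasurable
  ext E hE
  have h1 := h.measure_inter_sample hs (A := Function.update (fun _ => Set.univ) j E) (measurableSet_update_univ hE j)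
  rw [Fintype.prod_eq_single j (fun i hi => by simp [Function.update_of_ne hi]),
    Function.update_self] at h1
  rw [← h1, Measure.map_apply (h.measurable_sample hs j) hE, batch_preimage_pi_update]

/-- All sampled points are independent. -/
theorem IsRun.iIndepFun_sample [NeZero m] (h : IsRun μ H T ℱ net rhat xi) :
    iIndepFun (fun p : Fin T × Fin m => sample rhat xi p.1 p.2) μ := by
  have hm : ∀ p : Fin T × Fin m, Measurable (sample rhat xi p.1 p.2) :=
    fun p => h.measurable_sample p.1.2 p.2
  have hprob : ∀ p : Fin T × Fin m, IsProbabilityMeasure (μ.map (sample rhat xi p.1 p.2)) :=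
    fun p => Measure.isProbabilityMeasure_map (hm p).aemeasurable
  rw [iIndepFun_iff_map_fun_eq_pi_map fun p => (hm p).aemeasurable]
  refine (Measure.pi_eq fun A hA => ?_).symm
  set A' : ℕ → Fin m → Set (Design N) := fun s j => if hs : s < T then A (⟨s, hs⟩, j) else Set.univ
    with hA'
  have hA'm : ∀ s j, MeasurableSet (A' s j) := by
    intro s j
    simp only [hA']
    split_ifs
    exacts [hA _, MeasurableSet.univ]
  have hA'v : ∀ (s : Fin T) j, A' s j = A (s, j) := fun s j => by simp [hA']
  have h1 := (h.measure_iInter_batch (E := fun s => Set.univ.pi (A' s))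
    (fun s => MeasurableSet.univ_pi (hA'm s)) T le_rfl).2
  rw [Measure.map_apply (measurable_pi_lambda _ hm) (MeasurableSet.univ_pi hA)]
  calc _ = μ (⋂ s ∈ Finset.range T, batch rhat xi s ⁻¹' Set.univ.pi (A' s)) := by
        congr 1
        ext ω
        simp only [Set.mem_preimage, Set.mem_univ_pi, Set.mem_iInter, Finset.mem_range]
        refine ⟨fun hω s hs j => ?_, fun hω p => ?_⟩
        · have := hω (⟨s, hs⟩, j)
          rwa [← hA'v] at this
        · have := hω p.1 p.1.2 p.2
          rwa [hA'v] at this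
    _ = ∏ s ∈ Finset.range T, μ (batch rhat xi s ⁻¹' Set.univ.pi (A' s)) := h1
    _ = ∏ s : Fin T, μ (batch rhat xi s ⁻¹' Set.univ.pi (A' s)) :=
        (Fin.prod_univ_eq_prod_range (fun s => μ (batch rhat xi s ⁻¹' Set.univ.pi (A' s))) T).symm
    _ = ∏ p : Fin T × Fin m, μ.map (sample rhat xi p.1 p.2) (A p) := by
        rw [Fintype.prod_prod_type]
        refine Finset.prod_congr rfl fun s _ => ?_
        rw [h.measure_inter_sample s.2 (hA'm s)]
        refine Finset.prod_congr rfl fun j _ => ?_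
        rw [hA'v, h.map_sample s.2]

end Run

end Independence

/-! ### Hoeffding's inequality and the union bound for the truncated loss -/

section Concentration

/-- **Hoeffding's inequality** for the lower tail of a sum of independent `[0, b]`-valued variables. -/
theorem measureReal_le_sum_integral_sub_le {Ω ι : Type*} [MeasurableSpace Ω] {μ : Measure Ω}
    [IsProbabilityMeasure μ] [Fintype ι] {X : ι → Ω → ℝ} (hind : iIndepFun X μ)
    (hX : ∀ i, AEMeasurable (X i) μ) {b : ℝ} (hb : ∀ i, ∀ᵐ ω ∂μ, X i ω ∈ Set.Icc 0 b) {t : ℝ}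
    (ht : 0 ≤ t) :
    μ.real {ω | t ≤ ∑ i, (μ[X i] - X i ω)} ≤ Real.exp (-(2 * t ^ 2) / (Fintype.card ι * b ^ 2)) := by
  -- Hoeffding's lemma: a variable on an interval of length `b` has variance proxy `(b / 2)²`.
  have hsub : ∀ i ∈ Finset.univ, HasSubgaussianMGF (fun ω => μ[X i] - X i ω)
      ((‖b - 0‖₊ / 2) ^ 2) μ := by
    intro i _
    have h := (hasSubgaussianMGF_of_mem_Icc (hX i) (hb i)).neg
    refine h.congr (ae_of_all _ fun ω => ?_)
    simp
  have hind' : iIndepFun (fun i ω => μ[X i] - X i ω) μ :=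
    hind.comp (fun i y => (∫ ω, X i ω ∂μ) - y) fun i => measurable_const.sub measurable_id
  refine (HasSubgaussianMGF.measure_sum_ge_le_of_iIndepFun hind' hsub ht).trans_eq ?_
  congr 1
  simp only [sub_zero, Finset.sum_const, Finset.card_univ, nsmul_eq_mul, NNReal.coe_mul,
    NNReal.coe_natCast, NNReal.coe_pow, NNReal.coe_div, coe_nnnorm, Real.norm_eq_abs,
    NNReal.coe_ofNat, div_pow, sq_abs]
  rw [show (2 : ℝ) * (Fintype.card ι * (b ^ 2 / 2 ^ 2)) = Fintype.card ι * b ^ 2 / 2 by ring,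
    div_div_eq_mul_div]
  ring_nf

/-- The squared error of `f`, truncated at `B²`. -/
def truncLoss {N : ℕ} (B : ℝ) (F f : Design N → ℝ) (x : Design N) : ℝ :=
  min ((F x - f x) ^ 2) (B ^ 2)

theorem truncLoss_mem_Icc {N : ℕ} (B : ℝ) (F f : Design N → ℝ) (x : Design N) :
    truncLoss B F f x ∈ Set.Icc 0 (B ^ 2) :=
  ⟨le_min (sq_nonneg _) (sq_nonneg _), min_le_right _ _⟩

theorem measurable_truncLoss {N : ℕ} {B : ℝ} {F f : Design N → ℝ} (hF : Measurable F)
    (hf : Measurable f) : Measurable (truncLoss B F f) :=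
  ((hF.sub hf).pow_const 2).min measurable_const

theorem integrable_truncLoss {N : ℕ} {B : ℝ} {F f : Design N → ℝ} (hF : Measurable F)
    (hf : Measurable f) (ν : Measure (Design N)) [IsFiniteMeasure ν] :
    Integrable (truncLoss B F f) ν :=
  Integrable.of_mem_Icc 0 (B ^ 2) (measurable_truncLoss hF hf).aemeasurable
    (ae_of_all _ (truncLoss_mem_Icc B F f))

/-- The map `a ↦ min (a², B²)` is `2B`-Lipschitz on `a ≥ 0`, since it is flat beyond `B`. -/
theorem truncLoss_sub_le {N : ℕ} {B η : ℝ} (hB : 0 ≤ B) {F f g : Design N → ℝ} {x : Design N}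
    (h : |f x - g x| ≤ η) : truncLoss B F f x ≤ truncLoss B F g x + 2 * B * η := by
  have h1 : |F x - f x| ≤ |F x - g x| + η := by
    have := abs_sub_le (F x) (g x) (f x)
    rw [abs_sub_comm (g x)] at this
    linarith
  have hη : 0 ≤ η := (abs_nonneg _).trans h
  have hBη : 0 ≤ B * η := mul_nonneg hB hη
  unfold truncLoss
  rw [← sq_abs (F x - f x), ← sq_abs (F x - g x)]
  have ha0 := abs_nonneg (F x - f x)
  have hb0 := abs_nonneg (F x - g x)
  generalize |F x - f x| = a, |F x - g x| = b at h1 ha0 hb0 ⊢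
  rcases le_total (b ^ 2) (B ^ 2) with hb | hb
  · rw [min_eq_left hb]
    have hbB : b ≤ B := (pow_le_pow_iff_left₀ hb0 hB two_ne_zero).1 hb
    -- Applied to `c = min (a, B)`.
    have key : ∀ c, 0 ≤ c → c ≤ B → c ≤ b + η → c ^ 2 ≤ b ^ 2 + 2 * B * η := by
      intro c hc hcB hcb
      rcases le_total c b with hle | hle
      · nlinarith [pow_le_pow_left₀ hc hle 2]
      · nlinarith [mul_le_mul (show c - b ≤ η by linarith) (show c + b ≤ 2 * B by linarith)
          (by linarith) hη]
    rcases le_total a B with haB | haB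
    · exact (min_le_left _ _).trans (key a ha0 haB h1)
    · exact (min_le_right _ _).trans (key B hB le_rfl (haB.trans h1))
  · rw [min_eq_right hb]
    exact (min_le_right _ _).trans (by linarith)

variable {Ω : Type*} [mΩ : MeasurableSpace Ω] {μ : Measure Ω}
  {N m T : ℕ}
  {H : Set (Design N → ℝ)} {ℱ : Filtration ℕ mΩ} {net : ℕ → Ω → Design N → ℝ}
  {rhat : ℕ → Ω → Design N} {xi : ℕ → Fin m → Ω → Design N}

/-- The average over the first `T` batches of the expected truncated loss. -/
def avgTruncLoss {Ω : Type*} [MeasurableSpace Ω] (μ : Measure Ω) {N m : ℕ} [NeZero m]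
    (rhat : ℕ → Ω → Design N) (xi : ℕ → Fin m → Ω → Design N) (B : ℝ)
    (F f : Design N → ℝ) (T : ℕ) : ℝ :=
  (∑ s ∈ Finset.range T, ∫ x, truncLoss B F f x ∂(batchLaw μ rhat xi s)) / T

/-- The empirical mean of the truncated loss. -/
def empTruncLoss {N m T : ℕ} (B : ℝ) (F f : Design N → ℝ) (x : Fin T → Fin m → Design N) : ℝ :=
  (∑ s, ∑ j, truncLoss B F f (x s j)) / ((m : ℝ) * T)

theorem measurableSet_box (N : ℕ) : MeasurableSet (box N) := by
  have : box N = ⋂ i, {x : Design N | 0 ≤ x i ∧ x i ≤ 1} := by ext; simp [box]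
  rw [this]
  refine MeasurableSet.iInter fun i => ?_
  have hi : Measurable fun x : Design N => x i := (by fun_prop : Continuous _).measurable
  exact (measurableSet_le measurable_const hi).inter (measurableSet_le hi measurable_const)

theorem IsRun.ae_dataset_mem_box (h : IsRun μ H T ℱ net rhat xi) :
    ∀ᵐ ω ∂μ, ∀ s j, dataset rhat xi T ω s j ∈ box N :=
  ae_all_iff.2 fun s => ae_all_iff.2 fun j => h.sample_mem s s.2 j

variable [NeZero m]

theorem IsRun.ae_mem_box (h : IsRun μ H T ℱ net rhat xi) {s : ℕ} (hs : s < T) :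
    ∀ᵐ x ∂batchLaw μ rhat xi s, x ∈ box N :=
  (ae_map_iff (h.measurable_sample hs 0).aemeasurable (measurableSet_box N)).2 (h.sample_mem s hs 0)

variable [IsProbabilityMeasure μ]

theorem IsRun.isProbabilityMeasure_batchLaw (h : IsRun μ H T ℱ net rhat xi) {s : ℕ} (hs : s < T) :
    IsProbabilityMeasure (batchLaw μ rhat xi s) :=
  Measure.isProbabilityMeasure_map (h.measurable_sample hs 0).aemeasurable

/-- Concentration of the empirical truncated loss of one fixed function. -/
theorem IsRun.measureReal_le_avg_sub_emp_le (h : IsRun μ H T ℱ net rhat xi) (hT : 1 ≤ T)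
    {B t : ℝ} (ht : 0 ≤ t) {F g : Design N → ℝ} (hF : Measurable F) (hg : Measurable g) :
    μ.real {ω | t ≤ avgTruncLoss μ rhat xi B F g T - empTruncLoss B F g (dataset rhat xi T ω)} ≤
      Real.exp (-(2 * ((m : ℝ) * T) * t ^ 2) / B ^ 4) := by
  have hφ := measurable_truncLoss (B := B) hF hg
  have hm0 : (0 : ℝ) < m := by exact_mod_cast NeZero.pos m
  have hT0 : (0 : ℝ) < T := by exact_mod_cast hT
  have hind := h.iIndepFun_sample.comp (fun _ => truncLoss B F g) fun _ => hφ
  have hmain := measureReal_le_sum_integral_sub_le hind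
    (fun p => (hφ.comp (h.measurable_sample p.1.2 p.2)).aemeasurable)
    (fun p => ae_of_all _ fun ω => truncLoss_mem_Icc B F g _) (t := (m : ℝ) * T * t) (by positivity)
  have hint : ∀ p : Fin T × Fin m, μ[truncLoss B F g ∘ sample rhat xi p.1 p.2] =
      ∫ x, truncLoss B F g x ∂(batchLaw μ rhat xi p.1) := by
    intro p
    rw [← h.map_sample p.1.2 p.2,
      integral_map (h.measurable_sample p.1.2 p.2).aemeasurable hφ.aestronglyMeasurable]
    rfl
  refine (le_of_eq ?_).trans (hmain.trans_eq ?_)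
  · congr 1
    ext ω
    simp only [Set.mem_ofPred_eq]
    have hsum : ∑ p : Fin T × Fin m, (μ[truncLoss B F g ∘ sample rhat xi p.1 p.2] -
        (truncLoss B F g ∘ sample rhat xi p.1 p.2) ω) = (m : ℝ) * T *
        (avgTruncLoss μ rhat xi B F g T - empTruncLoss B F g (dataset rhat xi T ω)) := by
      simp only [hint]
      rw [Finset.sum_sub_distrib, Fintype.sum_prod_type, Fintype.sum_prod_type, mul_sub]
      congr 1
      · simp only [Finset.sum_const, Finset.card_univ, Fintype.card_fin, nsmul_eq_mul,
          avgTruncLoss, ← Finset.mul_sum]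
        rw [Fin.sum_univ_eq_sum_range
          (fun s => ∫ x, truncLoss B F g x ∂(batchLaw μ rhat xi s)) T]
        field_simp
      · simp only [empTruncLoss, dataset, Function.comp]
        field_simp
    rw [hsum]
    exact (mul_le_mul_iff_right₀ (by positivity)).symm
  · congr 1
    rw [Fintype.card_prod, Fintype.card_fin, Fintype.card_fin]
    push_cast
    rcases eq_or_ne B 0 with rfl | hB
    · simp
    · field_simp

/-- Passing from `f` to an approximation `g` changes the truncated risks by at most `2Bη`. -/
theorem IsRun.avg_le_emp_add (h : IsRun μ H T ℱ net rhat xi) (hT : 1 ≤ T)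
    {B t η : ℝ} (hB : 0 ≤ B) {F f g : Design N → ℝ} (hF : Measurable F) (hf : Measurable f)
    (hg : Measurable g) (hfg : ∀ x ∈ box N, |f x - g x| ≤ η) {x : Fin T → Fin m → Design N}
    (hx : ∀ s j, x s j ∈ box N)
    (hgx : avgTruncLoss μ rhat xi B F g T - empTruncLoss B F g x ≤ t) :
    avgTruncLoss μ rhat xi B F f T ≤ empTruncLoss B F f x + t + 4 * B * η := by
  have hm0 : (0 : ℝ) < m := by exact_mod_cast NeZero.pos m
  have hT0 : (0 : ℝ) < T := by exact_mod_cast hT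
  have h1 : avgTruncLoss μ rhat xi B F f T ≤ avgTruncLoss μ rhat xi B F g T + 2 * B * η := by
    unfold avgTruncLoss
    rw [div_add' _ _ _ hT0.ne', div_le_div_iff_of_pos_right hT0]
    calc _ ≤ ∑ s ∈ Finset.range T, (∫ x, truncLoss B F g x ∂(batchLaw μ rhat xi s) + 2 * B * η) := by
          refine Finset.sum_le_sum fun s hs => ?_
          have hs' := Finset.mem_range.1 hs
          have := h.isProbabilityMeasure_batchLaw hs'
          have h2 : ∫ x, (truncLoss B F g x + 2 * B * η) ∂(batchLaw μ rhat xi s) =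
              ∫ x, truncLoss B F g x ∂(batchLaw μ rhat xi s) + 2 * B * η := by
            rw [integral_add (integrable_truncLoss hF hg _) (integrable_const _)]
            simp
          rw [← h2]
          refine integral_mono_ae (integrable_truncLoss hF hf _)
            ((integrable_truncLoss hF hg _).add (integrable_const _)) ?_
          filter_upwards [h.ae_mem_box hs'] with x hx using truncLoss_sub_le hB (hfg x hx)
      _ = _ := by rw [Finset.sum_add_distrib]; simp; ring
  have h3 : empTruncLoss B F g x ≤ empTruncLoss B F f x + 2 * B * η := by
    unfold empTruncLoss
    rw [div_add' _ _ _ (by positivity), div_le_div_iff_of_pos_right (by positivity)]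
    calc _ ≤ ∑ s, ∑ j, (truncLoss B F f (x s j) + 2 * B * η) := by
          refine Finset.sum_le_sum fun s _ => Finset.sum_le_sum fun j _ => truncLoss_sub_le hB ?_
          rw [abs_sub_comm]
          exact hfg _ (hx s j)
      _ = _ := by simp [Finset.sum_add_distrib]; ring
  linarith

/-- Union bound over a finite net. -/
theorem IsRun.exists_good_set (h : IsRun μ H T ℱ net rhat xi) (hT : 1 ≤ T) {B t δ : ℝ}
    (ht : 0 ≤ t) {F : Design N → ℝ} (hF : Measurable F) (S : Finset (Design N → ℝ))
    (hS : ∀ g ∈ S, Measurable g)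
    (hδ : S.card * Real.exp (-(2 * ((m : ℝ) * T) * t ^ 2) / B ^ 4) ≤ δ) :
    ∃ G : Set (Fin T → Fin m → Design N), MeasurableSet G ∧
      ENNReal.ofReal (1 - δ) ≤ μ.map (dataset rhat xi T) G ∧
      ∀ x ∈ G, (∀ s j, x s j ∈ box N) ∧
        ∀ g ∈ S, avgTruncLoss μ rhat xi B F g T - empTruncLoss B F g x ≤ t := by
  have hemp : ∀ g ∈ S, Measurable (empTruncLoss (m := m) (T := T) B F g) := by
    intro g hg
    have hφ := measurable_truncLoss (B := B) hF (hS g hg)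
    unfold empTruncLoss
    refine Measurable.div_const (Finset.measurable_sum _ fun s _ => Finset.measurable_sum _
      fun j _ => hφ.comp ?_) _
    exact (measurable_pi_apply j).comp (measurable_pi_apply s)
  set bad : (Design N → ℝ) → Set (Fin T → Fin m → Design N) := fun g =>
    {x | t < avgTruncLoss μ rhat xi B F g T - empTruncLoss B F g x} with hbad
  -- The net approximates only on the box, so the good set must keep the data there; this costs no
  -- probability.
  set K : Set (Fin T → Fin m → Design N) := {x | ∀ s j, x s j ∈ box N} with hK
  have hKm : MeasurableSet K := by
    simp only [hK, Set.ofPred_forall]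
    exact MeasurableSet.iInter fun s => MeasurableSet.iInter fun j =>
      ((measurable_pi_apply j).comp (measurable_pi_apply s)) (measurableSet_box N)
  have hbm : MeasurableSet (⋃ g ∈ S, bad g) := Finset.measurableSet_biUnion S fun g hg =>
    measurableSet_lt measurable_const (measurable_const.sub (hemp g hg))
  have hdm := h.measurable_dataset
  have hprob : IsProbabilityMeasure (μ.map (dataset rhat xi T)) :=
    Measure.isProbabilityMeasure_map hdm.aemeasurable
  refine ⟨(⋃ g ∈ S, bad g)ᶜ ∩ K, hbm.compl.inter hKm, ?_, ?_⟩
  · have hKae : ∀ᵐ x ∂μ.map (dataset rhat xi T), x ∈ K :=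
      (ae_map_iff hdm.aemeasurable hKm).2 h.ae_dataset_mem_box
    have h1 : μ.map (dataset rhat xi T) ((⋃ g ∈ S, bad g)ᶜ ∩ K) =
        μ.map (dataset rhat xi T) (⋃ g ∈ S, bad g)ᶜ := by
      refine measure_congr ?_
      filter_upwards [hKae] with x hx
      exact propext ⟨fun hx => hx.1, fun hx' => ⟨hx', hx⟩⟩
    rw [h1, ← ofReal_measureReal, probReal_compl_eq_one_sub hbm]
    refine ENNReal.ofReal_le_ofReal (sub_le_sub_left (le_trans ?_ hδ) _)
    calc _ ≤ ∑ g ∈ S, (μ.map (dataset rhat xi T)).real (bad g) := measureReal_biUnion_finset_le _ _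
      _ ≤ ∑ _g ∈ S, Real.exp (-(2 * ((m : ℝ) * T) * t ^ 2) / B ^ 4) := by
          refine Finset.sum_le_sum fun g hg => ?_
          have hbg : MeasurableSet (bad g) :=
            measurableSet_lt measurable_const (measurable_const.sub (hemp g hg))
          rw [map_measureReal_apply hdm hbg]
          refine le_trans (measureReal_mono fun ω hω => ?_)
            (h.measureReal_le_avg_sub_emp_le hT ht hF (hS g hg))
          exact (show t < _ from hω).le
      _ = _ := by simp
  · rintro x ⟨hx, hxK⟩
    refine ⟨hxK, fun g hg => ?_⟩
    by_contra! hlt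
    exact hx (Set.mem_biUnion hg hlt)

end Concentration

/-! ### From the truncated mean loss to suboptimality -/

section SupBound

variable {Ω : Type*} [mΩ : MeasurableSpace Ω] {μ : Measure Ω}
  {N m T : ℕ}
  {H : Set (Design N → ℝ)} {ℱ : Filtration ℕ mΩ} {net : ℕ → Ω → Design N → ℝ}
  {rhat : ℕ → Ω → Design N} {xi : ℕ → Fin m → Ω → Design N}

/-- Some bound `R` is indispensable: the real `⨆` of an unbounded family is `0`. -/
theorem abs_sub_le_boxDist {F f : Design N → ℝ} {R : ℝ} (hR : ∀ x ∈ box N, |F x - f x| ≤ R)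
    {x : Design N} (hx : x ∈ box N) : |F x - f x| ≤ boxDist F f :=
  le_ciSup (f := fun x : box N => |F x - f x|) ⟨R, by rintro _ ⟨y, rfl⟩; exact hR y y.2⟩ ⟨x, hx⟩

variable [NeZero m]

theorem avgLoss_nonneg (F f : Design N → ℝ) (t : ℕ) : 0 ≤ avgLoss μ rhat xi F f t :=
  div_nonneg (Finset.sum_nonneg fun _ _ => integral_nonneg fun _ => sq_nonneg _) (Nat.cast_nonneg _)

variable [IsProbabilityMeasure μ]

/-- The comparison of sup-distance and mean squared error survives truncation. -/
theorem IsRun.min_sq_boxDist_le (h : IsRun μ H T ℱ net rhat xi) {B c R : ℝ}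
    {F f : Design N → ℝ} (hF : Measurable F) (hf : Measurable f)
    (hR : ∀ x ∈ box N, |F x - f x| ≤ R) (hc : 0 ≤ c)
    (hsup : boxDist F f ^ 2 ≤ c * avgLoss μ rhat xi F f T) :
    min (boxDist F f ^ 2) (B ^ 2) ≤ c * avgTruncLoss μ rhat xi B F f T := by
  set S := boxDist F f with hS
  -- Integrated form of `min (S², B²) * u ≤ S² * min (u, B²)` for `u = (F - f)² ≤ S²`.
  have hmul : min (S ^ 2) (B ^ 2) * avgLoss μ rhat xi F f T ≤
      S ^ 2 * avgTruncLoss μ rhat xi B F f T := by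
    unfold avgLoss avgTruncLoss
    rw [← mul_div_assoc, ← mul_div_assoc, Finset.mul_sum, Finset.mul_sum]
    refine div_le_div_of_nonneg_right (Finset.sum_le_sum fun s hs => ?_) (Nat.cast_nonneg _)
    have hs' := Finset.mem_range.1 hs
    have := h.isProbabilityMeasure_batchLaw hs'
    rw [← integral_const_mul, ← integral_const_mul]
    have hi : Integrable (fun x => (F x - f x) ^ 2) (batchLaw μ rhat xi s) := by
      refine Integrable.of_mem_Icc 0 (R ^ 2) ((hF.sub hf).pow_const 2).aemeasurable ?_
      filter_upwards [h.ae_mem_box hs'] with x hx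
      exact ⟨sq_nonneg _, sq_le_sq' (by linarith [neg_abs_le (F x - f x), hR x hx])
        ((le_abs_self _).trans (hR x hx))⟩
    refine integral_mono_ae (hi.const_mul _) ((integrable_truncLoss hF hf _).const_mul _) ?_
    filter_upwards [h.ae_mem_box hs'] with x hx
    have hxS : (F x - f x) ^ 2 ≤ S ^ 2 := by
      rw [← sq_abs (F x - f x)]
      exact pow_le_pow_left₀ (abs_nonneg _) (abs_sub_le_boxDist hR hx) 2
    change _ ≤ S ^ 2 * min ((F x - f x) ^ 2) (B ^ 2)
    rcases le_total ((F x - f x) ^ 2) (B ^ 2) with hle | hle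
    · rw [min_eq_left hle]
      exact mul_le_mul_of_nonneg_right (min_le_left _ _) (sq_nonneg _)
    · rw [min_eq_right hle, mul_comm (S ^ 2)]
      exact mul_le_mul (min_le_right _ _) hxS (sq_nonneg _) (sq_nonneg _)
  have hT0 : 0 ≤ avgTruncLoss μ rhat xi B F f T :=
    div_nonneg (Finset.sum_nonneg fun _ _ => integral_nonneg fun x => (truncLoss_mem_Icc B F f x).1)
      (Nat.cast_nonneg _)
  rcases (sq_nonneg S).eq_or_lt with hS0 | hS0
  · exact (min_le_left _ _).trans (hS0 ▸ mul_nonneg hc hT0)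
  · refine le_of_mul_le_mul_left ?_ hS0
    calc S ^ 2 * min (S ^ 2) (B ^ 2) ≤ c * avgLoss μ rhat xi F f T * min (S ^ 2) (B ^ 2) :=
          mul_le_mul_of_nonneg_right hsup (le_min (sq_nonneg _) (sq_nonneg _))
      _ = c * (min (S ^ 2) (B ^ 2) * avgLoss μ rhat xi F f T) := by ring
      _ ≤ c * (S ^ 2 * avgTruncLoss μ rhat xi B F f T) := mul_le_mul_of_nonneg_left hmul hc
      _ = _ := by ring

/-- The suboptimality of a minimizer of `f` for the objective `F`. -/
theorem sq_sub_le_min {B R : ℝ} {F f : Design N → ℝ} (hR : ∀ x ∈ box N, |F x - f x| ≤ R)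
    (hB : ∀ x ∈ box N, |F x| ≤ B) {r r₀ : Design N} (hr : IsBoxMin f r) (hr₀ : IsBoxMin F r₀) :
    (F r - F r₀) ^ 2 ≤ 4 * min (boxDist F f ^ 2) (B ^ 2) := by
  have h0 := hr₀.2 r hr.1
  have h1 := hr.2 r₀ hr₀.1
  -- Replacing `F` by `f` at `r` and at `r₀` costs one sup-distance each, while `f r ≤ f r₀`; the
  -- bound on `F` gives the alternative `2B`.
  have h2 := abs_le.1 (abs_sub_le_boxDist hR hr.1)
  have h3 := abs_le.1 (abs_sub_le_boxDist hR hr₀.1)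
  have h4 := abs_le.1 (hB r hr.1)
  have h5 := abs_le.1 (hB r₀ hr₀.1)
  rcases min_choice (boxDist F f ^ 2) (B ^ 2) with h | h <;> rw [h]
  · calc _ ≤ (2 * boxDist F f) ^ 2 := pow_le_pow_left₀ (by linarith) (by linarith) 2
      _ = _ := by ring
  · calc _ ≤ (2 * B) ^ 2 := pow_le_pow_left₀ (by linarith) (by linarith) 2
      _ = _ := by ring

end SupBound

/-! ### Two networks that differ on the box -/

section Nontrivial

variable {w : ℕ → ℕ} {D : ℕ}

theorem preact_zero (x : Design (w 0)) : ∀ k, 1 ≤ k → preact (0 : Weights w) k x = 0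
  | 1, _ => by simp [preact]
  | k + 2, _ => by simp [preact]

/-- With positive weights and inputs, no ReLU ever cuts anything off. -/
theorem preact_pos {W : Weights w} (hW : ∀ k i j, 0 < W k i j) {x : Design (w 0)}
    (hx : ∀ i, 0 < x i) : ∀ k, (∀ i < k, 1 ≤ w i) → ∀ i, 0 < preact W k x i
  | 0, _, i => hx i
  | 1, hw, i => by
    have : Nonempty (Fin (w 0)) := ⟨⟨0, hw 0 one_pos⟩⟩
    change 0 < ∑ j : Fin (w 0), W 0 i j * x j
    exact Finset.sum_pos (fun j _ => mul_pos (hW _ _ _) (hx j)) Finset.univ_nonempty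
  | k + 2, hw, i => by
    have : Nonempty (Fin (w (k + 1))) := ⟨⟨0, hw (k + 1) (by omega)⟩⟩
    change 0 < ∑ j : Fin (w (k + 1)), W (k + 1) i j * relu (preact W (k + 1) x) j
    refine Finset.sum_pos (fun j _ => mul_pos (hW _ _ _) ?_) Finset.univ_nonempty
    exact lt_max_of_lt_left (preact_pos hW hx (k + 1) (fun i hi => hw i (by omega)) j)

open scoped Matrix.Norms.L2Operator in
/-- The network class separates some point of the box. -/
theorem exists_netClass_ne (hD : 1 ≤ D) (hw : ∀ k ≤ D, 1 ≤ w k) (hout : w D = 1) {M : ℝ}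
    (hM : 0 < M) : ∃ f ∈ netClass hout M, ∃ g ∈ netClass hout M, ∃ x ∈ box (w 0), f x ≠ g x := by
  set J : Weights w := fun _ => Matrix.of fun _ _ => 1 with hJ
  set W : Weights w := fun k => (M / (1 + ‖J k‖)) • J k with hW
  refine ⟨_, ⟨0, fun k _ => ?_, rfl⟩, _, ⟨W, fun k _ => ?_, rfl⟩, WithLp.toLp 2 fun _ => 1,
    fun i => by simp, ?_⟩
  · exact (norm_zero (E := Matrix (Fin (w (k + 1))) (Fin (w k)) ℝ)).trans_le hM.le
  · have h0 : 0 ≤ ‖J k‖ := norm_nonneg _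
    change ‖(M / (1 + ‖J k‖)) • J k‖ ≤ M
    rw [norm_smul, Real.norm_of_nonneg (by positivity), div_mul_eq_mul_div, div_le_iff₀ (by positivity)]
    nlinarith
  · refine ne_of_lt ?_
    unfold network
    rw [preact_zero _ D hD]
    refine preact_pos (fun k i j => ?_) (fun i => ?_) D (fun i hi => hw i hi.le) _
    · have h0 : 0 ≤ ‖J k‖ := norm_nonneg _
      simp only [hW, hJ, Matrix.smul_apply, Matrix.of_apply, smul_eq_mul, mul_one]
      exact div_pos hM (by positivity)
    · simp

end Nontrivial

/-! ### Fitting the constants and the asymptotic rate -/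

section Numerics

theorem sqrt_add_le_sqrt_add_sqrt {x y : ℝ} (hx : 0 ≤ x) (hy : 0 ≤ y) : √(x + y) ≤ √x + √y := by
  refine Real.sqrt_le_iff.2 ⟨by positivity, ?_⟩
  rw [add_sq, Real.sq_sqrt hx, Real.sq_sqrt hy]
  linarith [mul_nonneg (Real.sqrt_nonneg x) (Real.sqrt_nonneg y)]

/-- Bernoulli's inequality; it moves a constant out of the logarithm. -/
theorem log_one_add_mul_le {z : ℝ} (hz : 0 ≤ z) (k : ℕ) :
    Real.log (1 + k * z) ≤ k * Real.log (1 + z) := by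
  rw [← Real.log_pow]
  exact Real.log_le_log (by positivity) (one_add_mul_le_pow (by linarith) k)

/-- The union bound at the level used for a net of at most `A ^ p` functions. -/
theorem mul_exp_deviation_le {B A δ n : ℝ} {p : ℕ} {M : ℕ} (hB : 0 < B) (hA : 1 ≤ A) (hδ : 0 < δ)
    (hδ1 : δ < 1) (hn : 0 < n) (hM : (M : ℝ) ≤ A ^ p) :
    M * Real.exp (-(2 * n * (B ^ 2 * √((p * Real.log A + Real.log (1 / δ)) / (2 * n))) ^ 2) /
      B ^ 4) ≤ δ := by
  have hlog : 0 ≤ Real.log (1 / δ) := Real.log_nonneg (by rw [le_div_iff₀ hδ]; linarith)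
  have hlogA : 0 ≤ Real.log A := Real.log_nonneg hA
  -- The deviation level is the one at which Hoeffding's exponent cancels the net size and leaves
  -- `δ`.
  have h1 : -(2 * n * (B ^ 2 * √((p * Real.log A + Real.log (1 / δ)) / (2 * n))) ^ 2) / B ^ 4 =
      -(Real.log (A ^ p) + Real.log (1 / δ)) := by
    rw [mul_pow, Real.sq_sqrt (by positivity), Real.log_pow]
    field_simp
  have hA0 : 0 < A := by linarith
  rw [h1, neg_add, Real.exp_add, Real.exp_neg, Real.exp_neg, Real.exp_log (by positivity),
    Real.exp_log (by positivity), one_div, inv_inv, ← mul_assoc]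
  refine mul_le_of_le_one_left hδ.le ?_
  rw [← div_eq_mul_inv]
  exact (div_le_one (by positivity)).2 hM

/-- The deviation splits into a net part, with constant `20` against the available `96`, and a
confidence part using `1/2` of the available `12`. The remaining `11.5` absorbs the approximation
error `13 * B² / √n`; the term `8 / n` is slack. -/
theorem deviation_add_approx_le_statError {B M δ n : ℝ} {D d : ℕ} (hB : 1 / 100 ≤ B) (hM : 0 < M)
    (hδ : 0 < δ) (hδ1 : δ < 1) (hn : 0 < n) :
    B ^ 2 * √((((d ^ 2 * D : ℕ) : ℝ) * Real.log (1 + 2 * M ^ D * D * √d / (13 * B / (4 * √n))) +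
      Real.log (1 / δ)) / (2 * n)) + 4 * B * (13 * B / (4 * √n)) ≤ statError B M D d δ n := by
  have hB0 : 0 < B := by linarith
  have hsn : 0 < √n := Real.sqrt_pos.2 hn
  set Z : ℝ := 8 * B * M ^ D * D * √(n * d) with hZ
  have hZ0 : 0 ≤ Z := by positivity
  set ℓ : ℝ := Real.log (1 + Z) with hℓ
  have hℓ0 : 0 ≤ ℓ := Real.log_nonneg (by linarith)
  set p : ℝ := (d : ℝ) ^ 2 * D with hp
  have hp0 : 0 ≤ p := by positivity
  set lam : ℝ := Real.log (2 / δ) with hlam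
  have hδlog : 0 ≤ Real.log (1 / δ) := Real.log_nonneg (by rw [le_div_iff₀ hδ]; linarith)
  have hlam_eq : lam = Real.log 2 + Real.log (1 / δ) := by
    rw [hlam, ← Real.log_mul (by norm_num) (by positivity)]; ring_nf
  have hl2 := Real.log_two_gt_d9
  have hlam0 : 0 ≤ lam := by linarith
  have hlogA : Real.log (1 + 2 * M ^ D * D * √d / (13 * B / (4 * √n))) ≤ 770 * ℓ := by
    have h1 : 2 * M ^ D * D * √d / (13 * B / (4 * √n)) = (1 / (13 * B ^ 2)) * Z := by
      rw [hZ, Real.sqrt_mul hn.le]; field_simp; ring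
    -- `B ≥ 1/100` gives `10000 / 13 < 770`.
    have h2 : 1 / (13 * B ^ 2) ≤ 770 := by
      rw [div_le_iff₀ (by positivity)]; nlinarith
    rw [h1]
    refine le_trans (Real.log_le_log (by positivity) ?_) (log_one_add_mul_le hZ0 770)
    have := mul_le_mul_of_nonneg_right h2 hZ0
    push_cast
    linarith
  have hdev : √((((d ^ 2 * D : ℕ) : ℝ) * Real.log (1 + 2 * M ^ D * D * √d / (13 * B / (4 * √n))) +
      Real.log (1 / δ)) / (2 * n)) ≤ 20 * √(p * ℓ) / √n + √(2 * lam / n) / 2 := by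
    refine (Real.sqrt_le_sqrt (y := (20 ^ 2 * (p * ℓ)) / n + (2 * lam / n) / 2 ^ 2) ?_).trans
      ((sqrt_add_le_sqrt_add_sqrt (by positivity) (by positivity)).trans (le_of_eq ?_))
    · have h3 : 20 ^ 2 * (p * ℓ) / n + 2 * lam / n / 2 ^ 2 = (800 * (p * ℓ) + lam) / (2 * n) := by
        field_simp; ring
      rw [h3]
      refine div_le_div_of_nonneg_right ?_ (by positivity)
      push_cast
      have := mul_le_mul_of_nonneg_left hlogA hp0
      have hpl : 0 ≤ p * ℓ := by positivity
      nlinarith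
    · rw [Real.sqrt_div (by positivity), Real.sqrt_mul (by norm_num), Real.sqrt_sq (by norm_num),
        Real.sqrt_div (by positivity) (2 ^ 2), Real.sqrt_sq (by norm_num)]
  -- As `δ < 1`, `2 * lam ≥ 2 * log 2 > 1.38`, which exceeds `(13 / 11.5)² < 1.28`.
  have happ : 13 / √n ≤ 11.5 * √(2 * lam / n) := by
    rw [Real.sqrt_div (by positivity), ← mul_div_assoc]
    refine div_le_div_of_nonneg_right ?_ hsn.le
    have : (13 / 11.5 : ℝ) ≤ √(2 * lam) := Real.le_sqrt_of_sq_le (by norm_num; linarith)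
    linarith
  have h4 : 4 * B * (13 * B / (4 * √n)) = B ^ 2 * (13 / √n) := by field_simp
  have h5 : B ^ 2 * (20 * √(p * ℓ) / √n) ≤ 96 * B ^ 2 / √n * √(p * ℓ) := by
    have : 0 ≤ B ^ 2 * √(p * ℓ) / √n := by positivity
    calc _ = 20 * (B ^ 2 * √(p * ℓ) / √n) := by ring
      _ ≤ 96 * (B ^ 2 * √(p * ℓ) / √n) := by linarith
      _ = _ := by ring
  rw [h4]
  unfold statError
  rw [← hZ, ← hℓ, ← hp, ← hlam]
  have h6 := mul_le_mul_of_nonneg_left hdev (sq_nonneg B)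
  have h7 := mul_le_mul_of_nonneg_left happ (sq_nonneg B)
  have h8 : 0 ≤ 8 / n := by positivity
  linarith

/-- Once `log n ≥ 1`, constants inside the logarithm become factors: `log (1 + a√n) ≤ log (1 + a) +
log n ≤ (log (1 + a) + 1) log n`. -/
theorem statError_isBigO {B M δ : ℝ} {D d : ℕ} (hB : 0 ≤ B) (hM : 0 ≤ M) :
    (fun n : ℕ => statError B M D d δ n) =O[atTop] fun n : ℕ => √(Real.log n / n) := by
  set a : ℝ := 8 * B * M ^ D * D * √d with ha
  have ha0 : 0 ≤ a := by positivity
  have hlog1 : ∀ᶠ n : ℕ in atTop, 1 ≤ Real.log n ∧ (1 : ℝ) ≤ n := by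
    filter_upwards [(Real.tendsto_log_atTop.comp tendsto_natCast_atTop_atTop).eventually_ge_atTop 1,
      eventually_ge_atTop 1] with n h1 h2
    exact ⟨h1, by exact_mod_cast h2⟩
  refine IsBigO.add (IsBigO.add ?_ ?_) ?_
  · refine IsBigO.of_bound (96 * B ^ 2 * √((d : ℝ) ^ 2 * D * (Real.log (1 + a) + 1))) ?_
    filter_upwards [hlog1] with n ⟨hl, hn⟩
    have hn0 : (0 : ℝ) < n := by linarith
    have hla : 0 ≤ Real.log (1 + a) := Real.log_nonneg (by linarith)
    rw [Real.norm_of_nonneg (by positivity), Real.norm_of_nonneg (by positivity)]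
    have h1 : Real.log (1 + 8 * B * M ^ D * D * √(n * d)) ≤ (Real.log (1 + a) + 1) * Real.log n := by
      have h2 : 1 + 8 * B * M ^ D * D * √(n * d) ≤ (1 + a) * n := by
        have hsq : √(n : ℝ) ≤ n := Real.sqrt_le_iff.2 ⟨hn0.le, by nlinarith⟩
        rw [Real.sqrt_mul hn0.le]
        have := mul_le_mul_of_nonneg_left hsq ha0
        calc _ = 1 + a * √n := by rw [ha]; ring
          _ ≤ _ := by nlinarith
      refine (Real.log_le_log (by positivity) h2).trans ?_
      rw [Real.log_mul (by positivity) hn0.ne']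
      nlinarith
    calc _ ≤ 96 * B ^ 2 / √n * √((d : ℝ) ^ 2 * D * ((Real.log (1 + a) + 1) * Real.log n)) := by
          gcongr
      _ = _ := by
          rw [← mul_assoc, Real.sqrt_mul (by positivity), Real.sqrt_div (by linarith)]
          ring
  -- The absolute value is needed because `δ` is arbitrary here.
  · refine IsBigO.of_bound (12 * B ^ 2 * √(2 * |Real.log (2 / δ)|)) ?_
    filter_upwards [hlog1] with n ⟨hl, hn⟩
    rw [Real.norm_of_nonneg (by positivity), Real.norm_of_nonneg (by positivity),
      mul_assoc (12 * B ^ 2), ← Real.sqrt_mul (by positivity)]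
    refine mul_le_mul_of_nonneg_left (Real.sqrt_le_sqrt ?_) (by positivity)
    rw [← mul_div_assoc]
    refine div_le_div_of_nonneg_right ?_ (by linarith)
    nlinarith [le_abs_self (Real.log (2 / δ)), abs_nonneg (Real.log (2 / δ))]
  · refine IsBigO.of_bound 8 ?_
    filter_upwards [hlog1] with n ⟨hl, hn⟩
    rw [Real.norm_of_nonneg (by positivity), Real.norm_of_nonneg (by positivity), div_eq_mul_one_div]
    refine mul_le_mul_of_nonneg_left (Real.le_sqrt_of_sq_le ?_) (by norm_num)
    have hn0 : (0 : ℝ) < n := by linarith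
    rw [div_pow, div_le_div_iff₀ (by positivity) hn0]
    nlinarith [mul_le_mul_of_nonneg_left hl (sq_nonneg (n : ℝ))]

end Numerics

end Solo

end

/-! ### The main theorem -/

theorem theorem1 {Ω : Type*} [mΩ : MeasurableSpace Ω] (μ : Measure Ω) [IsProbabilityMeasure μ]
    -- architecture: `D ≥ 1` layers, positive widths, scalar output
    (D : ℕ) (hD : 1 ≤ D) (w : ℕ → ℕ) (hw : ∀ k ≤ D, 1 ≤ w k) (hout : w D = 1)
    -- the objective and a global minimizer of it
    (F : Solo.Design (w 0) → ℝ) (hF : Measurable F)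
    (rstar : Solo.Design (w 0)) (hstar : Solo.IsBoxMin F rstar)
    -- boundedness of the weights and of the objective
    (BW BF B : ℝ) (hBW : 0 < BW) (hBF : 0 < BF) (hFB : ∀ x ∈ Solo.box (w 0), |F x| ≤ BF)
    (hB : B = max BF (BW ^ D)) (hB_scale : 1 / 100 ≤ B)
    -- the run of the algorithm: `T` iterations, `m` new samples in each
    (T m : ℕ) (hT : 1 ≤ T) [NeZero m]
    (ℱ : Filtration ℕ mΩ) (net : ℕ → Ω → Solo.Design (w 0) → ℝ)
    (rhat : ℕ → Ω → Solo.Design (w 0)) (xi : ℕ → Fin m → Ω → Solo.Design (w 0))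
    (hrun : Solo.IsRun μ (Solo.netClass hout BW) T ℱ net rhat xi)
    -- sup-norm versus average squared error
    (C : ℕ → ℝ) (hC : AntitoneOn C (Set.Icc 1 T))
    (hsup : ∀ t, 1 ≤ t → t ≤ T → ∀ f ∈ Solo.netClass hout BW,
      Solo.boxDist F f ^ 2 ≤ C t * Solo.avgLoss μ rhat xi F f t)
    (δ : ℝ) (hδ : 0 < δ) :
    -- with probability at least `1 - δ` over the training data, for every trained network
    (∃ G : Set (Fin T → Fin m → Solo.Design (w 0)), MeasurableSet G ∧
      ENNReal.ofReal (1 - δ) ≤ (μ.map (Solo.dataset rhat xi T)) G ∧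
      ∀ x ∈ G, ∀ f ∈ Solo.netClass hout BW, ∀ ε : ℝ, Solo.empMSE F f x ≤ ε →
        ∀ r, Solo.IsBoxMin f r →
          (F r - F rstar) ^ 2 ≤
            4 * C T * (Solo.statError B BW D (Solo.maxWidth w D) δ ((m : ℝ) * T) + ε)) ∧
    -- the statistical part decays like `n ^ (-1/2)` up to a logarithm
    (fun n : ℕ => Solo.statError B BW D (Solo.maxWidth w D) δ n) =O[atTop]
      (fun n : ℕ => √(Real.log n / n)) := by
  have hB0 : 0 < B := by linarith
  refine ⟨?_, Solo.statError_isBigO hB0.le hBW.le⟩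
  rcases le_or_gt 1 δ with hδ1 | hδ1
  · exact ⟨∅, MeasurableSet.empty, by simp [ENNReal.ofReal_of_nonpos (sub_nonpos.2 hδ1)], by simp⟩
  set d := Solo.maxWidth w D with hd
  set n : ℝ := (m : ℝ) * T with hn
  have hm0 : (0 : ℝ) < m := by exact_mod_cast NeZero.pos m
  have hT0 : (0 : ℝ) < T := by exact_mod_cast hT
  have hn0 : 0 < n := by positivity
  have hwd : ∀ k ≤ D, w k ≤ d := fun k hk =>
    Finset.le_sup (f := w) (Finset.mem_range.2 (by omega))
  -- At this net scale the approximation cost `4 * B * η` is `13 * B² / √n`.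
  have hη : 0 < 13 * B / (4 * √n) := by positivity
  obtain ⟨S, hSH, hSnet, hScard⟩ := Solo.exists_net_netClass hD hw hout hBW hη hwd
  have hmeas : ∀ f ∈ Solo.netClass hout BW, Measurable f := by
    rintro f ⟨W, -, rfl⟩
    exact (Solo.continuous_network hout W).measurable
  -- This crude bound only secures finite suprema and integrability; its `√N` does not reach the
  -- result.
  have hbound : ∀ f ∈ Solo.netClass hout BW, ∀ x ∈ Solo.box (w 0),
      |F x - f x| ≤ BF + BW ^ D * √(w 0) := by
    rintro f ⟨W, hW, rfl⟩ x hx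
    exact (abs_sub _ _).trans
      (add_le_add (hFB x hx) (Solo.abs_network_le hout hBW.le hW hx))
  -- `F` cannot agree with two networks at a point where they differ, so `hsup` has a positive left
  -- side for one of them.
  have hCpos : 0 < C T := by
    obtain ⟨f, hf, g, hg, x, hx, hne⟩ := Solo.exists_netClass_ne hD hw hout hBW
    have hpos : ∀ f ∈ Solo.netClass hout BW, F x ≠ f x → 0 < C T := by
      intro f hf hFf
      have h1 : 0 < Solo.boxDist F f :=
        (abs_pos.2 (sub_ne_zero.2 hFf)).trans_le (Solo.abs_sub_le_boxDist (hbound f hf) hx)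
      exact pos_of_mul_pos_left ((pow_pos h1 2).trans_le (hsup T hT le_rfl f hf))
        (Solo.avgLoss_nonneg F f T)
    by_cases hFf : F x = f x
    · exact hpos g hg fun h => hne (hFf.symm.trans h)
    · exact hpos f hf hFf
  set A : ℝ := 1 + 2 * BW ^ D * D * √d / (13 * B / (4 * √n)) with hA
  have hA1 : 1 ≤ A := le_add_of_nonneg_right (by positivity)
  set t : ℝ := B ^ 2 * √((((d ^ 2 * D : ℕ) : ℝ) * Real.log A + Real.log (1 / δ)) / (2 * n)) with ht
  obtain ⟨G, hGm, hGμ, hG⟩ := hrun.exists_good_set hT (B := B) (t := t) (by positivity) hF S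
    (fun g hg => hmeas g (hSH g hg)) (Solo.mul_exp_deviation_le hB0 hA1 hδ hδ1 hn0 hScard)
  refine ⟨G, hGm, hGμ, fun x hx f hf ε hε r hr => ?_⟩
  obtain ⟨hxbox, hxS⟩ := hG x hx
  obtain ⟨g, hgS, hfg⟩ := hSnet f hf
  have h1 := hrun.avg_le_emp_add hT hB0.le hF (hmeas f hf) (hmeas g (hSH g hgS)) hfg hxbox
    (hxS g hgS)
  have h2 : Solo.empTruncLoss B F f x ≤ ε := by
    refine le_trans (div_le_div_of_nonneg_right (Finset.sum_le_sum fun s _ =>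
      Finset.sum_le_sum fun j _ => min_le_left _ _) hn0.le) hε
  have h3 := Solo.deviation_add_approx_le_statError (D := D) (d := d) hB_scale hBW hδ hδ1 hn0
  rw [← hA, ← ht] at h3
  have h4 : Solo.avgTruncLoss μ rhat xi B F f T ≤ Solo.statError B BW D d δ n + ε := by linarith
  have h5 := hrun.min_sq_boxDist_le (B := B) hF (hmeas f hf) (hbound f hf) hCpos.le
    (hsup T hT le_rfl f hf)
  have hFB' : ∀ x ∈ Solo.box (w 0), |F x| ≤ B := fun x hx =>
    (hFB x hx).trans (hB ▸ le_max_left _ _)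
  have h6 := Solo.sq_sub_le_min (hbound f hf) hFB' hr hstar
  have h7 := mul_le_mul_of_nonneg_left h4 hCpos.le
  linarith
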